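/- Let $a\le b$ be real numbers. A function $A:[a,b]^2\to[a,b]$ is continuous, associative, and such that $a$ is a zero ($A(a,x)=A(x,a)=a$ for all $x$) and $b$ is an identity ($A(b,x)=A(x,b)=x$ for all $x$) if and only if at least one of the following holds: 1. $A(x,y)=\min(x,y)$ for all $x,y\in[a,b]$; 2. there exists a continuous strictly decreasing function $f:[a,b]\to[0,+\infty]$, with $f(b)=0$, such that $$A(x,y)=f^{-1}\bigl[\min\bigl(f(x)+f(y),\,f(a)\bigr)\bigr]\qquad(x,y\in[a,b])$$ (conjunctive Archimedean semigroup); 3. there exist an index set $K\subseteq\mathbb N$, a family of pairwise disjoint nonempty open subintervals $\{\,]a_k,b_k[\ \mid k\in K\}$ of $[a,b]$, and a family $\{f_k\mid k\in K\}$ of continuous strictly decreasing functions $f_k:[a_k,b_k]\to[0,+\infty]$, with $f_k(b_k)=0$, such that, for all $x,y\in[a,b]$, $$A(x,y)=\begin{cases} f_k^{-1}\bigl[\min\bigl(f_k(x)+f_k(y),\,f_k(a_k)\bigr)\bigr], & \text{if there is } k\in K \text{ with } x,y\in[a_k,b_k],\\ \min(x,y), & \text{otherwise}\end{cases}$$ (ordinal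 sum of conjunctive Archimedean semigroups and one-point semigroups). -/

import Mathlib

/-- The binary operation `A` on `E` is associative. -/
def IsAssociativeOp {E : Type*} (A : E → E → E) : Prop :=
  ∀ x y z : E, A (A x y) z = A x (A y z)

/-- `e` is an identity for `A`. -/
def IsIdentityElt {E : Type*} (A : E → E → E) (e : E) : Prop :=
  ∀ x : E, A e x = x ∧ A x e = x

/-- `e` is a zero (annihilator) for `A`. -/
def IsZeroElt {E : Type*} (A : E → E → E) (e : E) : Prop :=
  ∀ x : E, A e x = e ∧ A x e = e

/-- `f` restricts to a continuous strictly decreasing function `[c, d] → [0, +∞]` with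
`f d = 0`. Values of `f` outside `[c, d]` are irrelevant. -/
structure IsConjGenerator (c d : ℝ) (f : ℝ → ENNReal) : Prop where
  continuousOn : ContinuousOn f (Set.Icc c d)
  strictAntiOn : StrictAntiOn f (Set.Icc c d)
  map_right : f d = 0

/-- The operation `(x, y) ↦ f⁻¹[min (f x + f y, f c)]` on `[c, d]`, where `f⁻¹` is the inverse of
the restriction of `f` to `[c, d]`. When `f` is a generator on `[c, d]` the argument of `f⁻¹` lies
between `f d = 0` and `f c`, hence in the range of that restriction. -/
noncomputable def generatedOp (c d : ℝ) (f : ℝ → ENNReal) (x y : ℝ) : ℝ :=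
  Function.invFunOn f (Set.Icc c d) (min (f x + f y) (f c))

/-- `A` is the minimum operation on `[a, b]`. -/
def IsMinOp {a b : ℝ} (A : Set.Icc a b → Set.Icc a b → Set.Icc a b) : Prop :=
  ∀ x y : Set.Icc a b, A x y = min x y

/-- `A` is given on `[a, b]` by an additive generator (conjunctive Archimedean semigroup). -/
def IsConjArchimedeanOp {a b : ℝ} (A : Set.Icc a b → Set.Icc a b → Set.Icc a b) : Prop :=
  ∃ f : ℝ → ENNReal, IsConjGenerator a b f ∧
    ∀ x y : Set.Icc a b, (A x y : ℝ) = generatedOp a b f x y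

/-- `A` is an ordinal sum of countably many conjunctive Archimedean semigroups and of one-point
semigroups: on the square of each `[l k, r k]` it is given by a generator, and it is the minimum
elsewhere. -/
def IsConjOrdinalSumOp {a b : ℝ} (A : Set.Icc a b → Set.Icc a b → Set.Icc a b) : Prop :=
  ∃ (K : Set ℕ) (l r : ℕ → ℝ) (f : ℕ → ℝ → ENNReal),
    (∀ k ∈ K, a ≤ l k ∧ l k < r k ∧ r k ≤ b) ∧
    K.PairwiseDisjoint (fun k => Set.Ioo (l k) (r k)) ∧
    (∀ k ∈ K, IsConjGenerator (l k) (r k) (f k)) ∧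
    ∀ x y : Set.Icc a b,
      (∀ k ∈ K, (x : ℝ) ∈ Set.Icc (l k) (r k) → (y : ℝ) ∈ Set.Icc (l k) (r k) →
        (A x y : ℝ) = generatedOp (l k) (r k) (f k) x y) ∧
      ((¬ ∃ k ∈ K, (x : ℝ) ∈ Set.Icc (l k) (r k) ∧ (y : ℝ) ∈ Set.Icc (l k) (r k)) →
        A x y = min x y)

/-! Conditions 1 and 2 are ordinal sums with no block and with the single block `[a, b]` (none if `a
= b`), so it suffices to identify the semigroups in question with the ordinal sums.

Monotonicity is not assumed; compactness supplies it. An idempotent of a suitable compact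
subsemigroup yields `xy ≤ x` and `xy ≤ y` (`op_le_right`). By the intermediate value theorem every
`x ≤ y` is a multiple of `y` on either side, so multiplication is monotone. An idempotent between
`x` and `y` then forces `xy = min x y`. Hence only the gaps of the closed set of idempotents matter,
and there are countably many.

In a gap, powers of any element other than the identity tend to the zero, so nonzero products
cancel. Successive square roots `u n` of an interior element tend to the identity, and `u n ^ m`
plays the role of `exp (-m / 2 ^ n)`. The resulting logarithm `rootLog` is the generator. It
compares with a strict `x < u n ^ m`, so that its value at the zero may be finite, which gives the
truncation by `f 0`.

Conversely, a point outside all open blocks acts as a threshold: products across it are minima. This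
reduces associativity and monotonicity to single blocks, and monotonicity together with divisibility
gives continuity. -/

open Set Filter Topology

/-! ### Products lie below their factors -/

/-- In a compact linearly ordered topological semigroup whose least element is a right zero, left
translations do not increase any element. -/
theorem op_le_right {I : Type*} [ConditionallyCompleteLinearOrder I] [DenselyOrdered I]
    [TopologicalSpace I] [OrderTopology I] [CompactSpace I] (op : I → I → I)
    (hc : Continuous fun p : I × I => op p.1 p.2) (ha : ∀ x y z, op (op x y) z = op x (op y z))
    (z : I) (hz : ∀ x, z ≤ x) (hz' : ∀ x, op x z = z) (t x : I) : op t x ≤ x := by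
  by_contra! hlt
  have hcr : ∀ s, Continuous (op s) := fun s => hc.comp (by fun_prop : Continuous fun y => (s, y))
  have ivt : ∀ s p q, p ≤ op s q → ∃ k ≤ q, op s k = p := by
    intro s p q h
    obtain ⟨k, hk, rfl⟩ := intermediate_value_Icc (hz q) (hcr s).continuousOn
      ⟨(hz' s).symm ▸ hz p, h⟩
    exact ⟨k, hk.2, rfl⟩
  -- Since `op s z = z`, these are the `s` whose left translation maps `[z, x]` onto a set
  -- containing `[z, x]`. This property survives products and limits.
  set N : Set I := {s | ∃ k ≤ x, x ≤ op s k} with hN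
  have hNc : IsCompact N := by
    have : N = Prod.fst '' {p : I × I | p.2 ≤ x ∧ x ≤ op p.1 p.2} := by
      ext s; simp [hN]
    rw [this]
    exact (((isClosed_le continuous_snd continuous_const).inter
      (isClosed_le continuous_const hc)).isCompact).image continuous_fst
  have hNmul : ∀ s ∈ N, ∀ s' ∈ N, op s s' ∈ N := by
    rintro s ⟨k, hk, hxk⟩ s' ⟨k', hk', hxk'⟩
    obtain ⟨q, hq, hq'⟩ := ivt s' k k' (hk.trans hxk')
    exact ⟨q, hq.trans hk', by rw [ha, hq']; exact hxk⟩
  have htN : t ∈ N := ⟨x, le_rfl, hlt.le⟩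
  let _ : Semigroup I := { mul := op, mul_assoc := ha }
  -- The idempotent is sought in `t N`, not in `N`, so that it factors as `op t s` with `s ∈ N`. It
  -- fixes every `y ≤ x`; choosing `q ≤ x` with `op s q = x` gives `op t x = q ≤ x`.
  have hcl : ∀ r : I, Continuous (fun y : I => y * r) := fun r =>
    hc.comp (by fun_prop : Continuous fun y => (y, r))
  obtain ⟨e, ⟨s, hs, rfl⟩, he⟩ := exists_idempotent_in_compact_subsemigroup hcl (op t '' N)
    ⟨_, t, htN, rfl⟩ (hNc.image (hcr t)) (by
      rintro _ ⟨n, hn, rfl⟩ _ ⟨n', hn', rfl⟩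
      exact ⟨op n (op t n'), hNmul _ hn _ (hNmul _ htN _ hn'), (ha t n (op t n')).symm⟩)
  change op (op t s) (op t s) = op t s at he
  have hid : ∀ y ≤ x, op (op t s) y = y := by
    intro y hy
    obtain ⟨k, hk, hxk⟩ := hNmul _ htN _ hs
    obtain ⟨q, -, rfl⟩ := ivt _ y k (hy.trans hxk)
    rw [← ha, he]
  obtain ⟨k, hk, hxk⟩ := hs
  obtain ⟨q, hq, hq'⟩ := ivt s x k hxk
  have := hid q (hq.trans hk)
  rw [ha, hq'] at this
  exact absurd (this ▸ hq.trans hk) hlt.not_ge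

/-! ### Monotonicity, idempotents and powers in interval monoids -/

/-- A linearly ordered type whose least element is `0` and whose greatest element is `1`. -/
class IsZeroOneBounded (I : Type*) [LE I] [Zero I] [One I] : Prop where
  zero_le' : ∀ x : I, 0 ≤ x
  le_one' : ∀ x : I, x ≤ 1

namespace IntervalMonoid

open IsZeroOneBounded

variable {I : Type*} [ConditionallyCompleteLinearOrder I] [DenselyOrdered I]
  [TopologicalSpace I] [OrderTopology I] [CompactSpace I] [MonoidWithZero I] [ContinuousMul I]
  [IsZeroOneBounded I]

theorem mul_le_right (x y : I) : x * y ≤ y :=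
  op_le_right (fun x y : I => x * y) continuous_mul mul_assoc 0 zero_le' mul_zero x y

theorem mul_le_left (x y : I) : x * y ≤ x :=
  op_le_right (fun x y : I => y * x) (continuous_mul.comp continuous_swap)
    (fun x y z => (mul_assoc z y x).symm) 0 zero_le' zero_mul y x

omit [CompactSpace I] in
theorem exists_mul_right_eq {x y : I} (h : x ≤ y) : ∃ w, y * w = x := by
  obtain ⟨w, -, hw⟩ := intermediate_value_Icc (zero_le' (1 : I))
    (continuous_const_mul y).continuousOn
    (show x ∈ Icc (y * 0) (y * 1) by simpa using ⟨zero_le' x, h⟩)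
  exact ⟨w, hw⟩

omit [CompactSpace I] in
theorem exists_mul_left_eq {x y : I} (h : x ≤ y) : ∃ w, w * y = x := by
  obtain ⟨w, -, hw⟩ := intermediate_value_Icc (zero_le' (1 : I))
    (continuous_mul_const y).continuousOn
    (show x ∈ Icc (0 * y) (1 * y) by simpa using ⟨zero_le' x, h⟩)
  exact ⟨w, hw⟩

/-- Divisibility turns the order into multiplication: `x = v x'` and `y = y' w`, and extra factors
only decrease a product. -/
theorem mul_le_mul_of_le {x x' y y' : I} (hx : x ≤ x') (hy : y ≤ y') : x * y ≤ x' * y' := by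
  obtain ⟨v, rfl⟩ := exists_mul_left_eq hx
  obtain ⟨w, rfl⟩ := exists_mul_right_eq hy
  calc v * x' * (y' * w) = v * (x' * y' * w) := by simp only [mul_assoc]
    _ ≤ x' * y' * w := mul_le_right _ _
    _ ≤ x' * y' := mul_le_left _ _

omit [CompactSpace I] in
theorem idem_mul_of_le {e x : I} (he : e * e = e) (h : x ≤ e) : e * x = x := by
  obtain ⟨w, rfl⟩ := exists_mul_right_eq h
  rw [← mul_assoc, he]

omit [CompactSpace I] in
theorem mul_idem_of_le {e x : I} (he : e * e = e) (h : x ≤ e) : x * e = x := by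
  obtain ⟨w, rfl⟩ := exists_mul_left_eq h
  rw [mul_assoc, he]

/-- An idempotent between two elements forces their product to be their minimum. -/
theorem mul_eq_min_of_idem_between {e x y : I} (he : e * e = e) (h₁ : min x y ≤ e)
    (h₂ : e ≤ max x y) : x * y = min x y := by
  rcases le_total x y with h | h
  · rw [min_eq_left h] at h₁ ⊢
    rw [max_eq_right h] at h₂
    refine (mul_le_left x y).antisymm ?_
    calc x = x * e := (mul_idem_of_le he h₁).symm
      _ ≤ x * y := mul_le_mul_of_le le_rfl h₂
  · rw [min_eq_right h] at h₁ ⊢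
    rw [max_eq_left h] at h₂
    refine (mul_le_right x y).antisymm ?_
    calc y = e * y := (idem_mul_of_le he h₁).symm
      _ ≤ x * y := mul_le_mul_of_le h₂ le_rfl

theorem pow_antitone (x : I) : Antitone (fun n : ℕ => x ^ n) :=
  antitone_nat_of_succ_le fun n => by rw [pow_succ]; exact mul_le_left _ _

/-- The decreasing powers converge, and the limit is idempotent because `x ^ (2n)` has the same
limit as `x ^ n`. -/
theorem exists_tendsto_pow (x : I) : ∃ e ≤ x, e * e = e ∧
    Tendsto (fun n : ℕ => x ^ n) atTop (𝓝 e) := by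
  have hb : BddBelow (range fun n : ℕ => x ^ n) := ⟨0, by rintro _ ⟨n, rfl⟩; exact zero_le' _⟩
  have ht := tendsto_atTop_ciInf (pow_antitone x) hb
  refine ⟨_, by simpa using ciInf_le hb 1, ?_, ht⟩
  refine tendsto_nhds_unique (ht.mul ht) ?_
  have h2 : Tendsto (fun n : ℕ => n + n) atTop atTop :=
    tendsto_atTop_mono (fun n => Nat.le_add_left n n) tendsto_id
  simpa only [Function.comp_def, pow_add] using ht.comp h2

/-! ### Cancellation and square roots when only `0` and `1` are idempotent -/

section Archimedean

variable (hE : ∀ e : I, e * e = e → e = 0 ∨ e = 1)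
include hE

theorem tendsto_pow_zero {y : I} (hy : y < 1) : Tendsto (fun n : ℕ => y ^ n) atTop (𝓝 0) := by
  obtain ⟨e, hey, he, ht⟩ := exists_tendsto_pow y
  rcases hE e he with rfl | rfl
  · exact ht
  · exact absurd hy hey.not_gt

/-- Iteration gives `x = x * y ^ n` for all `n`; if `y ≠ 1`, the right side tends to `0`. -/
theorem eq_one_of_mul_eq_left {x y : I} (hx : x ≠ 0) (h : x * y = x) : y = 1 := by
  by_contra hne
  have hp : ∀ n : ℕ, x * y ^ n = x := fun n => by
    induction n with
    | zero => simp
    | succ n ih => rw [pow_succ, ← mul_assoc, ih, h]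
  have ht := (tendsto_pow_zero hE (lt_of_le_of_ne (le_one' y) hne)).const_mul x
  simp only [hp, mul_zero] at ht
  exact hx (tendsto_nhds_unique tendsto_const_nhds ht)

theorem eq_one_of_mul_eq_right {x y : I} (hx : x ≠ 0) (h : y * x = x) : y = 1 := by
  by_contra hne
  have hp : ∀ n : ℕ, y ^ n * x = x := fun n => by
    induction n with
    | zero => simp
    | succ n ih => rw [pow_succ, mul_assoc, h, ih]
  have ht := (tendsto_pow_zero hE (lt_of_le_of_ne (le_one' y) hne)).mul_const x
  simp only [hp, zero_mul] at ht
  exact hx (tendsto_nhds_unique tendsto_const_nhds ht)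

/-- Write `y = w * z`; equality would make `w` fix the nonzero element `z * x`, forcing `w = 1`. -/
theorem mul_lt_mul_right_of_pos {x y z : I} (h : y < z) (hpos : 0 < z * x) : y * x < z * x := by
  refine lt_of_le_of_ne (mul_le_mul_of_le h.le le_rfl) fun heq => h.ne ?_
  obtain ⟨w, rfl⟩ := exists_mul_left_eq h.le
  rw [mul_assoc] at heq
  rw [eq_one_of_mul_eq_right hE hpos.ne' heq, one_mul]

theorem pow_lt_pow_of_pos {c : I} (hc : c < 1) {m k : ℕ} (hmk : m < k) (hpos : 0 < c ^ m) :
    c ^ k < c ^ m := by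
  refine lt_of_le_of_lt (pow_antitone c (Nat.succ_le_of_lt hmk)) ?_
  change c ^ (m + 1) < c ^ m
  rw [pow_succ]
  refine lt_of_le_of_ne (mul_le_left _ _) fun h => hc.ne (eq_one_of_mul_eq_left hE hpos.ne' h)

omit [CompactSpace I] hE in
theorem exists_mul_self_eq (x : I) : ∃ s : I, s * s = x := by
  obtain ⟨s, -, hs⟩ := intermediate_value_Icc (zero_le' (1 : I))
    (continuous_id.mul continuous_id).continuousOn
    (show x ∈ Icc ((0 : I) * 0) (1 * 1) by simpa using ⟨zero_le' x, le_one' x⟩)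
  exact ⟨s, hs⟩

/-- A sequence of successive square roots of an interior element. -/
theorem exists_root_sequence [Nontrivial I] : ∃ u : ℕ → I, (∀ n, u (n + 1) * u (n + 1) = u n) ∧
    (∀ n, u n < 1) ∧ Tendsto u atTop (𝓝 1) := by
  obtain ⟨c, hc0, hc1⟩ := exists_between (lt_of_le_of_ne (zero_le' (1 : I)) zero_ne_one)
  choose s hs using exists_mul_self_eq (I := I)
  set u : ℕ → I := fun n => s^[n] c with hu
  have husq : ∀ n, u (n + 1) * u (n + 1) = u n := fun n => by
    simp only [hu, Function.iterate_succ_apply', hs]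
  have hmono : Monotone u := monotone_nat_of_le_succ fun n => by
    rw [← husq n]; exact mul_le_left _ _
  have hpos : ∀ n, 0 < u n := fun n => hc0.trans_le (hmono (Nat.zero_le n))
  have hlt : ∀ n, u n < 1 := fun n => by
    induction n with
    | zero => exact hc1
    | succ n ih =>
      refine lt_of_le_of_ne (le_one' _) fun h => ih.ne ?_
      rw [← husq n, h, one_mul]
  refine ⟨u, husq, hlt, ?_⟩
  have hb : BddAbove (range u) := ⟨1, by rintro _ ⟨n, rfl⟩; exact le_one' _⟩
  have ht := tendsto_atTop_ciSup hmono hb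
  have ht' := ht.comp (tendsto_add_atTop_nat 1)
  -- The limit of the increasing roots is idempotent and at least `u 0 > 0`, hence equal to `1`.
  have hidem := tendsto_nhds_unique (ht'.mul ht') (by simpa only [Function.comp_def, husq] using ht)
  rcases hE _ hidem with h | h
  · exact absurd h ((hpos 0).trans_le (le_ciSup hb 0)).ne'
  · rwa [h] at ht

end Archimedean

end IntervalMonoid

/-! ### The dyadic logarithm as additive generator -/

namespace IntervalMonoid

open IsZeroOneBounded

/-- The dyadic number `m / 2 ^ n`. -/
noncomputable def dyadic (n m : ℕ) : ENNReal := m * 2⁻¹ ^ n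

theorem dyadic_add (n m k : ℕ) : dyadic n (m + k) = dyadic n m + dyadic n k := by
  simp [dyadic, add_mul]

theorem dyadic_refine (n k m : ℕ) : dyadic (n + k) (m * 2 ^ k) = dyadic n m := by
  have : (2 : ENNReal) ^ k * 2⁻¹ ^ k = 1 := by
    rw [← mul_pow, ENNReal.mul_inv_cancel (by simp) (by simp), one_pow]
  simp only [dyadic, pow_add, Nat.cast_mul, Nat.cast_pow, Nat.cast_ofNat]
  calc (m : ENNReal) * 2 ^ k * (2⁻¹ ^ n * 2⁻¹ ^ k) = m * 2⁻¹ ^ n * (2 ^ k * 2⁻¹ ^ k) := by ring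
    _ = _ := by rw [this, mul_one]

theorem dyadic_lt_top (n m : ℕ) : dyadic n m < ⊤ := by
  unfold dyadic
  exact ENNReal.mul_lt_top (by simp) (by simp)

theorem dyadic_pos (n : ℕ) {m : ℕ} (hm : 0 < m) : 0 < dyadic n m := by
  unfold dyadic
  have : (m : ENNReal) ≠ 0 := by exact_mod_cast hm.ne'
  refine pos_iff_ne_zero.2 (mul_ne_zero this (by simp))

theorem tendsto_dyadic (m : ℕ) : Tendsto (fun n => dyadic n m) atTop (𝓝 0) := by
  have h := ENNReal.tendsto_pow_atTop_nhds_zero_of_lt_one (r := 2⁻¹) (by simp)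
  have := ENNReal.Tendsto.const_mul (a := (m : ENNReal)) h (Or.inr (by simp))
  simpa [dyadic] using this

theorem exists_dyadic_floor (n : ℕ) {t : ENNReal} (ht : t < ⊤) :
    ∃ m, dyadic n m ≤ t ∧ t < dyadic n (m + 1) := by
  classical
  have hex : ∃ m, t < dyadic n m := ENNReal.exists_nat_mul_gt (by simp) ht.ne
  obtain ⟨m, hm⟩ : ∃ m, Nat.find hex = m + 1 := Nat.exists_eq_succ_of_ne_zero fun h => by
    have := Nat.find_spec hex
    rw [h] at this
    simp [dyadic] at this
  refine ⟨m, not_lt.1 (Nat.find_min hex (by omega)), hm ▸ Nat.find_spec hex⟩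

variable {I : Type*} [ConditionallyCompleteLinearOrder I] [DenselyOrdered I]
  [TopologicalSpace I] [OrderTopology I] [CompactSpace I] [MonoidWithZero I] [ContinuousMul I]
  [IsZeroOneBounded I]

theorem root_pow_refine {M : Type*} [Monoid M] {u : ℕ → M} (husq : ∀ n, u (n + 1) * u (n + 1) = u n)
    (n k m : ℕ) :
    u (n + k) ^ (m * 2 ^ k) = u n ^ m := by
  induction k generalizing m with
  | zero => simp
  | succ k ih =>
    rw [← ih m, ← husq (n + k), ← pow_two, ← pow_mul, pow_succ]
    congr 1
    ring

/-- The supremum of the dyadic numbers `m / 2 ^ n` for which the `m`-th power of the `n`-th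
root `u n` exceeds `x`. -/
noncomputable def rootLog (u : ℕ → I) (x : I) : ENNReal :=
  ⨆ (p : ℕ × ℕ) (_ : x < u p.1 ^ p.2), dyadic p.1 p.2

omit [DenselyOrdered I] [OrderTopology I] [CompactSpace I] [ContinuousMul I] [IsZeroOneBounded I]
  [TopologicalSpace I] in
theorem le_rootLog {u : ℕ → I} {x : I} {n m : ℕ} (h : x < u n ^ m) : dyadic n m ≤ rootLog u x :=
  le_iSup₂_of_le (n, m) h le_rfl

section

variable {u : ℕ → I} (husq : ∀ n, u (n + 1) * u (n + 1) = u n)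
include husq

theorem root_pow_le_of_dyadic_le {n m k j : ℕ} (h : dyadic k j ≤ dyadic n m) :
    u n ^ m ≤ u k ^ j := by
  rw [← root_pow_refine husq n k m, ← root_pow_refine husq k n j, add_comm k n]
  refine pow_antitone _ ?_
  by_contra! hlt
  rw [← dyadic_refine n k m, ← dyadic_refine k n j, add_comm k n] at h
  obtain ⟨d, hd⟩ := Nat.exists_eq_add_of_lt hlt
  rw [hd, add_assoc, dyadic_add] at h
  exact h.not_gt (ENNReal.lt_add_right (dyadic_lt_top _ _).ne (dyadic_pos _ (Nat.succ_pos d)).ne')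

theorem rootLog_le {x : I} {n m : ℕ} (h : u n ^ m ≤ x) : rootLog u x ≤ dyadic n m := by
  refine iSup₂_le fun p hp => le_of_not_gt fun hlt => ?_
  exact ((root_pow_le_of_dyadic_le husq hlt.le).trans h).not_gt hp

theorem rootLog_one : rootLog u 1 = 0 := by
  have := rootLog_le husq (x := 1) (n := 0) (m := 0) (by simp)
  simpa [dyadic] using this

omit husq [DenselyOrdered I] [OrderTopology I] [CompactSpace I] [ContinuousMul I]
  [IsZeroOneBounded I] [TopologicalSpace I] in
theorem rootLog_antitone : Antitone (rootLog u) := fun _ _ h =>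
  iSup₂_le fun _ hp => le_rootLog (h.trans_lt hp)

variable (hE : ∀ e : I, e * e = e → e = 0 ∨ e = 1) (hlt : ∀ n, u n < 1)
include hE hlt

omit husq in
/-- An element other than `0` lies between two consecutive powers of each root. -/
theorem exists_root_pow_between {x : I} (hx : 0 < x) (n : ℕ) :
    ∃ m, u n ^ (m + 1) ≤ x ∧ x ≤ u n ^ m ∧ dyadic n m ≤ rootLog u x := by
  classical
  have hex : ∃ m, u n ^ (m + 1) ≤ x :=
    (((tendsto_pow_zero hE (hlt n)).comp (tendsto_add_atTop_nat 1)).eventually_le_const hx).exists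
  refine ⟨Nat.find hex, Nat.find_spec hex, ?_⟩
  rcases Nat.eq_zero_or_eq_succ_pred (Nat.find hex) with h | h
  · rw [h]; simp [le_one', dyadic]
  · have hmin := not_le.1 (Nat.find_min hex (m := (Nat.find hex).pred) (by omega))
    rw [← Nat.succ_eq_add_one, ← h] at hmin
    exact ⟨hmin.le, le_rootLog hmin⟩

theorem rootLog_mul_le (x y : I) : rootLog u (x * y) ≤ rootLog u x + rootLog u y := by
  rcases (zero_le' x).eq_or_lt with rfl | hx
  · simp
  rcases (zero_le' y).eq_or_lt with rfl | hy
  · simp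
  -- Rounding each factor to a power of `u n` costs one grid step, so the total error is `dyadic n
  -- 2`, which vanishes in the limit.
  refine ge_of_tendsto' (by simpa using (tendsto_dyadic 2).const_add (rootLog u x + rootLog u y))
    fun n => ?_
  obtain ⟨m, hm, -, hmx⟩ := exists_root_pow_between hE hlt hx n
  obtain ⟨k, hk, -, hky⟩ := exists_root_pow_between hE hlt hy n
  calc rootLog u (x * y) ≤ dyadic n (m + 1 + (k + 1)) :=
        rootLog_le husq (by rw [pow_add]; exact mul_le_mul_of_le hm hk)
    _ = dyadic n m + dyadic n k + dyadic n 2 := by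
        rw [← dyadic_add, ← dyadic_add]; congr 1; omega
    _ ≤ _ := by gcongr

-- Strict bounds on the factors multiply to a strict bound only where products are nonzero. When `x
-- * y = 0`, the sum may exceed `rootLog u 0`.
omit hlt in
theorem rootLog_add_le {x y : I} (hxy : 0 < x * y) :
    rootLog u x + rootLog u y ≤ rootLog u (x * y) := by
  rcases (le_one' x).eq_or_lt with rfl | hx
  · simp [rootLog_one husq]
  rcases (le_one' y).eq_or_lt with rfl | hy
  · simp [rootLog_one husq]
  -- Adding suprema requires nonempty index sets; `(0, 0)` belongs to both because `u 0 ^ 0 = 1`.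
  refine ENNReal.biSup_add_biSup_le' ⟨(0, 0), by simpa using hx⟩ ⟨(0, 0), by simpa using hy⟩ ?_
  rintro ⟨n, m⟩ hm ⟨k, j⟩ hj
  simp only at hm hj ⊢
  have hle : x * y ≤ x * u k ^ j := mul_le_mul_of_le le_rfl hj.le
  have hle' : x * u k ^ j ≤ u n ^ m * u k ^ j := mul_le_mul_of_le hm.le le_rfl
  have hlt' := hle.trans_lt (mul_lt_mul_right_of_pos hE hm (hxy.trans_le (hle.trans hle')))
  rw [← root_pow_refine husq n k m, ← root_pow_refine husq k n j, add_comm k n, ← pow_add] at hlt'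
  have := le_rootLog hlt'
  rwa [dyadic_add, dyadic_refine, add_comm n k, dyadic_refine] at this

theorem rootLog_mul (x y : I) :
    rootLog u (x * y) = min (rootLog u x + rootLog u y) (rootLog u 0) := by
  refine le_antisymm (le_min (rootLog_mul_le husq hE hlt x y) (rootLog_antitone (zero_le' _))) ?_
  rcases (zero_le' (x * y)).eq_or_lt with h | h
  · rw [← h]; exact min_le_right _ _
  · exact (min_le_left _ _).trans (rootLog_add_le husq hE h)

/-- Choose `n` with `x < u n ^ 2 * y` and place `y` between `u n ^ (m + 1)` and `u n ^ m`. Then `x <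
u n ^ (m + 2)`: one factor absorbs the rounding of `y`, the other separates the two values. -/
theorem rootLog_strictAnti (hu : Tendsto u atTop (𝓝 1)) : StrictAnti (rootLog u) := by
  intro x y hxy
  have hy : 0 < y := (zero_le' x).trans_lt hxy
  have ht : Tendsto (fun n => u n * u n * y) atTop (𝓝 y) := by
    simpa using (hu.mul hu).mul_const y
  obtain ⟨n, hn⟩ := (ht.eventually_const_lt hxy).exists
  obtain ⟨m, hm, hm', -⟩ := exists_root_pow_between hE hlt hy n
  calc rootLog u y ≤ dyadic n (m + 1) := rootLog_le husq hm
    _ < dyadic n (m + 1) + dyadic n 1 :=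
      ENNReal.lt_add_right (dyadic_lt_top _ _).ne (dyadic_pos _ Nat.one_pos).ne'
    _ = dyadic n (2 + m) := by rw [← dyadic_add]; congr 1; omega
    _ ≤ rootLog u x := by
      refine le_rootLog (hn.trans_le ?_)
      rw [pow_add, pow_two]
      exact mul_le_mul_of_le le_rfl hm'

/-- On a grid with `s + 2 / 2 ^ n < t`, let `m / 2 ^ n` be the rounding down of `s`; the power `u n
^ (m + 2)` is the required point. It is nonzero, since otherwise `rootLog u 0 < t`. -/
theorem exists_rootLog_between {s t : ENNReal} (hst : s < t) (ht : t ≤ rootLog u 0) :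
    ∃ x, s < rootLog u x ∧ rootLog u x < t := by
  have hd : Tendsto (fun n => s + dyadic n 2) atTop (𝓝 s) := by
    simpa using (tendsto_dyadic 2).const_add s
  obtain ⟨n, hn⟩ := (hd.eventually_lt_const hst).exists
  obtain ⟨m, hm, hm'⟩ := exists_dyadic_floor n (hst.trans_le le_top)
  have hlt' : dyadic n (m + 2) < t := by
    rw [dyadic_add]
    exact lt_of_le_of_lt (by gcongr) hn
  have hp : 0 < u n ^ (m + 2) := lt_of_not_ge fun h =>
    ((rootLog_le husq h).trans_lt (hlt'.trans_le ht)).false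
  refine ⟨u n ^ (m + 2), hm'.trans_le (le_rootLog ?_), (rootLog_le husq le_rfl).trans_lt hlt'⟩
  exact pow_lt_pow_of_pos hE (hlt n) (Nat.lt_succ_self _)
    (hp.trans_le (pow_antitone _ (Nat.le_succ _)))

theorem continuous_rootLog [Nontrivial I] (hu : Tendsto u atTop (𝓝 1)) :
    Continuous (rootLog u) := by
  have hanti := rootLog_strictAnti husq hE hlt hu
  -- A monotone map with dense range is continuous. The dual order makes the map monotone, and the
  -- range is dense only below `rootLog u 0`.
  let g : I → (Iic (rootLog u 0))ᵒᵈ := fun x =>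
    OrderDual.toDual ⟨rootLog u x, hanti.antitone (zero_le' x)⟩
  have hg : Monotone g := fun x y h => hanti.antitone h
  have hd : DenseRange g := by
    have : Nontrivial (Iic (rootLog u 0))ᵒᵈ :=
      ⟨g 0, g 1, fun h => zero_ne_one (hanti.injective (congrArg Subtype.val h))⟩
    refine dense_iff_exists_between.2 fun s t hst => ?_
    obtain ⟨x, hx, hx'⟩ := exists_rootLog_between husq hE hlt
      (s := (OrderDual.ofDual t).1) (t := (OrderDual.ofDual s).1) hst (OrderDual.ofDual s).2
    exact ⟨g x, ⟨x, rfl⟩, hx', hx⟩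
  exact continuous_subtype_val.comp (continuous_ofDual.comp (hg.continuous_of_denseRange hd))

end

/-- An interval monoid without interior idempotents has an additive generator. -/
theorem exists_generator [Nontrivial I] (hE : ∀ e : I, e * e = e → e = 0 ∨ e = 1) :
    ∃ f : I → ENNReal, Continuous f ∧ StrictAnti f ∧ f 1 = 0 ∧
      ∀ x y, f (x * y) = min (f x + f y) (f 0) := by
  obtain ⟨u, husq, hlt, hu⟩ := exists_root_sequence hE
  exact ⟨rootLog u, continuous_rootLog husq hE hlt hu, rootLog_strictAnti husq hE hlt hu,
    rootLog_one husq, rootLog_mul husq hE hlt⟩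

end IntervalMonoid

/-! ### Gaps between idempotents -/

namespace IntervalMonoid

open IsZeroOneBounded

/-- `l < r` are idempotents with no idempotent strictly between them. -/
structure IsGap {M : Type*} [Preorder M] [Mul M] (l r : M) : Prop where
  lt : l < r
  left_idem : l * l = l
  right_idem : r * r = r
  le_or_le : ∀ e : M, e * e = e → e ≤ l ∨ r ≤ e

/-- The endpoints of a gap are idempotent, so none lies strictly inside another gap. Overlapping
gaps therefore share both endpoints. -/
theorem IsGap.separated {M : Type*} [LinearOrder M] [Mul M] {l r l' r' : M} (h : IsGap l r)
    (h' : IsGap l' r') (hne : (l, r) ≠ (l', r')) : r ≤ l' ∨ r' ≤ l := by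
  by_contra! hcon
  refine hne (Prod.ext ?_ ?_)
  · exact ((h'.le_or_le l h.left_idem).resolve_right hcon.2.not_ge).antisymm
      ((h.le_or_le l' h'.left_idem).resolve_right hcon.1.not_ge)
  · exact ((h.le_or_le r' h'.right_idem).resolve_left hcon.2.not_ge).antisymm
      ((h'.le_or_le r h.right_idem).resolve_left hcon.1.not_ge)

variable {I : Type*} [ConditionallyCompleteLinearOrder I] [DenselyOrdered I]
  [TopologicalSpace I] [OrderTopology I] [CompactSpace I] [MonoidWithZero I] [ContinuousMul I]
  [IsZeroOneBounded I]

theorem mul_mem_Icc_of_idem {l r x y : I} (hl : l * l = l) (hx : x ∈ Icc l r) (hy : y ∈ Icc l r) :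
    x * y ∈ Icc l r :=
  ⟨hl ▸ mul_le_mul_of_le hx.1 hy.1, (mul_le_left x y).trans hx.2⟩

/-- The elements between two idempotents form an interval monoid. -/
noncomputable abbrev iccMonoidWithZero {l r : I} (hlr : l ≤ r) (hl : l * l = l) (hr : r * r = r) :
    MonoidWithZero (Icc l r) where
  mul x y := ⟨x * y, mul_mem_Icc_of_idem hl x.2 y.2⟩
  mul_assoc x y z := Subtype.ext (mul_assoc (x : I) y z)
  one := ⟨r, right_mem_Icc.2 hlr⟩
  one_mul x := Subtype.ext (idem_mul_of_le hr x.2.2)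
  mul_one x := Subtype.ext (mul_idem_of_le hr x.2.2)
  zero := ⟨l, left_mem_Icc.2 hlr⟩
  zero_mul x := Subtype.ext <| show l * (x : I) = l by
    rw [mul_eq_min_of_idem_between hl (by simp) (by simp), min_eq_left x.2.1]
  mul_zero x := Subtype.ext <| show (x : I) * l = l by
    rw [mul_eq_min_of_idem_between hl (by simp) (by simp), min_eq_right x.2.1]

theorem IsGap.exists_generator {l r : I} (h : IsGap l r) : ∃ f : I → ENNReal,
    Continuous f ∧ StrictAntiOn f (Icc l r) ∧ f r = 0 ∧
      ∀ x ∈ Icc l r, ∀ y ∈ Icc l r, f (x * y) = min (f x + f y) (f l) := by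
  let _ : MonoidWithZero (Icc l r) := iccMonoidWithZero h.lt.le h.left_idem h.right_idem
  have : IsZeroOneBounded (Icc l r) := ⟨fun x => x.2.1, fun x => x.2.2⟩
  have : ContinuousMul (Icc l r) := ⟨Continuous.subtype_mk
    (continuous_mul.comp (continuous_subtype_val.prodMap continuous_subtype_val)) _⟩
  have : Nontrivial (Icc l r) := ⟨0, 1, fun h' => h.lt.ne (congrArg Subtype.val h')⟩
  let _ : Inhabited (Icc l r) := ⟨0⟩
  obtain ⟨f, hc, ha, h1, hm⟩ := IntervalMonoid.exists_generator (I := Icc l r) fun e he =>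
    (h.le_or_le e (congrArg Subtype.val he)).imp
      (fun h' => Subtype.ext (h'.antisymm e.2.1)) (fun h' => Subtype.ext (e.2.2.antisymm h'))
  have hf : ∀ x (hx : x ∈ Icc l r), f (projIcc l r h.lt.le x) = f ⟨x, hx⟩ := fun x hx => by
    rw [projIcc_of_mem h.lt.le hx]
  refine ⟨fun x => f (projIcc l r h.lt.le x), hc.comp continuous_projIcc, ?_, ?_, ?_⟩
  · intro x hx y hy hxy
    simp only [hf x hx, hf y hy]
    exact ha hxy
  · simp only [projIcc_right]; exact h1
  · intro x hx y hy
    simp only [hf x hx, hf y hy, hf _ (mul_mem_Icc_of_idem h.left_idem hx hy), projIcc_left]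
    exact hm ⟨x, hx⟩ ⟨y, hy⟩

omit [DenselyOrdered I] in
/-- Elements not separated by an idempotent lie in a common gap. -/
theorem exists_isGap {p q : I} (hpq : p ≤ q) (h : ∀ e : I, e * e = e → e < p ∨ q < e) :
    ∃ l r : I, IsGap l r ∧ l ≤ p ∧ q ≤ r := by
  have hE : IsClosed {e : I | e * e = e} := isClosed_eq (by fun_prop) continuous_id
  -- The idempotents form a closed set, so there is a greatest one below `p` and a least one above
  -- `q`.
  obtain ⟨l, ⟨hl, hlp⟩, hl'⟩ := ((hE.inter isClosed_Iic).isCompact (s := _ ∩ Iic p)).exists_isGreatest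
    ⟨0, mul_zero 0, zero_le' p⟩
  obtain ⟨r, ⟨hr, hqr⟩, hr'⟩ := ((hE.inter isClosed_Ici).isCompact (s := _ ∩ Ici q)).exists_isLeast
    ⟨1, mul_one 1, le_one' q⟩
  refine ⟨l, r, ⟨?_, hl, hr, fun e he => ?_⟩, hlp, hqr⟩
  · exact ((h l hl).resolve_right (hlp.trans hpq).not_gt).trans_le (hpq.trans hqr)
  · exact (h e he).imp (fun h' => hl' ⟨he, h'.le⟩) (fun h' => hr' ⟨he, h'.le⟩)

end IntervalMonoid

/-! ### Continuous operations are ordinal sums -/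

theorem IsConjGenerator.generatedOp_eq {c d : ℝ} {f : ℝ → ENNReal} (hf : IsConjGenerator c d f)
    {x y z : ℝ} (hz : z ∈ Icc c d) (h : f z = min (f x + f y) (f c)) :
    generatedOp c d f x y = z := by
  rw [generatedOp, ← h]
  exact hf.strictAntiOn.injOn.leftInvOn_invFunOn hz

open IntervalMonoid in
theorem isConjOrdinalSumOp_of_continuous {a b : ℝ} (hab : a ≤ b)
    {A : Icc a b → Icc a b → Icc a b} (hc : Continuous fun p : Icc a b × Icc a b => A p.1 p.2)
    (ha : IsAssociativeOp A) (h0 : IsZeroElt A ⟨a, left_mem_Icc.2 hab⟩)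
    (h1 : IsIdentityElt A ⟨b, right_mem_Icc.2 hab⟩) : IsConjOrdinalSumOp A := by
  let _ : MonoidWithZero (Icc a b) :=
    { mul := A, mul_assoc := ha
      one := ⟨b, right_mem_Icc.2 hab⟩, one_mul := fun x => (h1 x).1, mul_one := fun x => (h1 x).2
      zero := ⟨a, left_mem_Icc.2 hab⟩, zero_mul := fun x => (h0 x).1, mul_zero := fun x => (h0 x).2 }
  have : IsZeroOneBounded (Icc a b) := ⟨fun x => x.2.1, fun x => x.2.2⟩
  have : ContinuousMul (Icc a b) := ⟨hc⟩
  let _ : Inhabited (Icc a b) := ⟨0⟩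
  have hA : ∀ x y, A x y = x * y := fun _ _ => rfl
  set G : Set (Icc a b × Icc a b) := {p | IsGap p.1 p.2}
  -- Distinct gaps give disjoint nonempty open intervals in a separable space.
  have hcount : G.Countable := by
    refine PairwiseDisjoint.countable_of_isOpen (s := fun p => Ioo p.1 p.2) ?_
      (fun _ _ => isOpen_Ioo) (fun p hp => nonempty_Ioo.2 hp.lt)
    intro p hp q hq hne
    refine Set.disjoint_left.2 fun x hx hx' => ?_
    rcases IsGap.separated hp hq hne with h | h
    · exact (hx.2.trans_le (h.trans hx'.1.le)).false
    · exact (hx'.2.trans_le (h.trans hx.1.le)).false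
  obtain ⟨i, hi⟩ := countable_iff_exists_injOn.1 hcount
  have hgen : ∀ p : Icc a b × Icc a b, ∃ f : Icc a b → ENNReal, p ∈ G →
      Continuous f ∧ StrictAntiOn f (Icc p.1 p.2) ∧ f p.2 = 0 ∧
        ∀ x ∈ Icc p.1 p.2, ∀ y ∈ Icc p.1 p.2, f (x * y) = min (f x + f y) (f p.1) := fun p => by
    by_cases hp : p ∈ G
    · obtain ⟨f, hf⟩ := IsGap.exists_generator hp
      exact ⟨f, fun _ => hf⟩
    · exact ⟨0, fun h => absurd h hp⟩
  choose f hf using hgen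
  -- The injection `i` numbers the gaps; `d` decodes the numbers and is meaningful only on `i '' G`.
  set d : ℕ → Icc a b × Icc a b := Function.invFunOn i G with hd
  have hdG : ∀ k ∈ i '' G, d k ∈ G := fun k hk => Function.invFunOn_mem hk
  have hdi : ∀ p ∈ G, d (i p) = p := hi.leftInvOn_invFunOn
  have hgenK : ∀ k ∈ i '' G, IsConjGenerator (d k).1 (d k).2 (fun t => f (d k) (projIcc a b hab t)) := by
    intro k hk
    obtain ⟨hcf, haf, h1f, -⟩ := hf _ (hdG k hk)
    refine ⟨(hcf.comp continuous_projIcc).continuousOn, ?_, by simpa using h1f⟩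
    intro x hx y hy hxy
    have hx' : x ∈ Icc a b := ⟨(d k).1.2.1.trans hx.1, hx.2.trans (d k).2.2.2⟩
    have hy' : y ∈ Icc a b := ⟨(d k).1.2.1.trans hy.1, hy.2.trans (d k).2.2.2⟩
    simp only [projIcc_of_mem hab hx', projIcc_of_mem hab hy']
    exact haf hx hy hxy
  refine ⟨i '' G, fun k => (d k).1, fun k => (d k).2, fun k t => f (d k) (projIcc a b hab t),
    fun k hk => ⟨(d k).1.2.1, (hdG k hk).lt, (d k).2.2.2⟩, ?_, hgenK, fun x y => ⟨?_, ?_⟩⟩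
  · rintro _ ⟨p, hp, rfl⟩ _ ⟨q, hq, rfl⟩ hne
    simp only [Function.onFun, hdi p hp, hdi q hq]
    refine Set.disjoint_left.2 fun x hx hx' => ?_
    rcases IsGap.separated hp hq (fun h => hne (congrArg i h)) with h | h
    · exact (hx.2.trans_le ((Subtype.coe_le_coe.2 h).trans hx'.1.le)).false
    · exact (hx'.2.trans_le ((Subtype.coe_le_coe.2 h).trans hx.1.le)).false
  · intro k hk hx hy
    have hx' : x ∈ Icc (d k).1 (d k).2 := hx
    have hy' : y ∈ Icc (d k).1 (d k).2 := hy
    have hG' := hdG k hk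
    refine ((hgenK k hk).generatedOp_eq ?_ ?_).symm
    · exact mul_mem_Icc_of_idem hG'.left_idem hx' hy'
    · simpa [hA] using (hf _ hG').2.2.2 x hx' y hy'
  · intro hnot
    by_cases hsep : ∃ e : Icc a b, e * e = e ∧ min x y ≤ e ∧ e ≤ max x y
    · obtain ⟨e, he, h, h'⟩ := hsep
      exact mul_eq_min_of_idem_between he h h'
    · obtain ⟨l, r, hlr, hl, hr⟩ := exists_isGap (p := min x y) (q := max x y) min_le_max
        fun e he => by
          by_contra! h'
          exact hsep ⟨e, he, h'.1, h'.2⟩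
      have hp : (l, r) ∈ G := hlr
      refine absurd ⟨i (l, r), ⟨_, hp, rfl⟩, ?_⟩ hnot
      simp only [hdi _ hp]
      exact ⟨⟨hl.trans (min_le_left _ _), (le_max_left _ _).trans hr⟩,
        ⟨hl.trans (min_le_right _ _), (le_max_right _ _).trans hr⟩⟩

/-! ### Abstract ordinal sums: associativity, monotonicity, continuity -/

/-- `A` is an ordinal sum on a linear order: on each block `[l k, r k]` it is a naturally ordered
commutative semigroup with zero `l k` and identity `r k`, and it is the minimum elsewhere. -/
structure IsOrdinalSum {E ι : Type*} [LinearOrder E] (A : E → E → E) (K : Set ι) (l r : ι → E) :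
    Prop where
  lt : ∀ k ∈ K, l k < r k
  separated : ∀ k ∈ K, ∀ j ∈ K, k ≠ j → r k ≤ l j ∨ r j ≤ l k
  mem : ∀ k ∈ K, ∀ x ∈ Icc (l k) (r k), ∀ y ∈ Icc (l k) (r k), A x y ∈ Icc (l k) (r k)
  comm' : ∀ k ∈ K, ∀ x ∈ Icc (l k) (r k), ∀ y ∈ Icc (l k) (r k), A x y = A y x
  assoc' : ∀ k ∈ K, ∀ x ∈ Icc (l k) (r k), ∀ y ∈ Icc (l k) (r k), ∀ z ∈ Icc (l k) (r k),
    A (A x y) z = A x (A y z)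
  mono' : ∀ k ∈ K, ∀ x ∈ Icc (l k) (r k), ∀ x' ∈ Icc (l k) (r k), ∀ y ∈ Icc (l k) (r k),
    x ≤ x' → A x y ≤ A x' y
  right_zero : ∀ k ∈ K, ∀ x ∈ Icc (l k) (r k), A x (l k) = l k
  right_id : ∀ k ∈ K, ∀ x ∈ Icc (l k) (r k), A x (r k) = x
  surj' : ∀ k ∈ K, ∀ x ∈ Icc (l k) (r k), ∀ w ∈ Icc (l k) (r k), w ≤ x → ∃ y, A x y = w
  eq_min : ∀ x y, (¬ ∃ k ∈ K, x ∈ Icc (l k) (r k) ∧ y ∈ Icc (l k) (r k)) → A x y = min x y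

namespace IsOrdinalSum

variable {E ι : Type*} [LinearOrder E] {A : E → E → E} {K : Set ι} {l r : ι → E}
  (h : IsOrdinalSum A K l r)
include h

theorem comm (x y : E) : A x y = A y x := by
  by_cases hk : ∃ k ∈ K, x ∈ Icc (l k) (r k) ∧ y ∈ Icc (l k) (r k)
  · obtain ⟨k, hk, hx, hy⟩ := hk
    exact h.comm' k hk x hx y hy
  · rw [h.eq_min x y hk, h.eq_min y x (by simpa only [and_comm] using hk), min_comm]

theorem le_left (x y : E) : A x y ≤ x := by
  by_cases hk : ∃ k ∈ K, x ∈ Icc (l k) (r k) ∧ y ∈ Icc (l k) (r k)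
  · obtain ⟨k, hk, hx, hy⟩ := hk
    have hr : r k ∈ Icc (l k) (r k) := right_mem_Icc.2 (h.lt k hk).le
    calc A x y = A y x := h.comm x y
      _ ≤ A (r k) x := h.mono' k hk y hy _ hr x hx hy.2
      _ = A x (r k) := h.comm _ _
      _ = x := h.right_id k hk x hx
  · rw [h.eq_min x y hk]; exact min_le_left _ _

theorem le_right (x y : E) : A x y ≤ y := h.comm x y ▸ h.le_left y x

/-- Points outside all open blocks separate their two sides. -/
theorem eq_left_of_between {e x y : E} (he : ∀ k ∈ K, e ≤ l k ∨ r k ≤ e) (hx : x ≤ e) (hy : e ≤ y) :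
    A x y = x := by
  by_cases hk : ∃ k ∈ K, x ∈ Icc (l k) (r k) ∧ y ∈ Icc (l k) (r k)
  · obtain ⟨k, hk, hxk, hyk⟩ := hk
    rcases he k hk with h' | h'
    · rw [(hx.trans h').antisymm hxk.1, h.comm, h.right_zero k hk y hyk]
    · rw [hyk.2.antisymm (h'.trans hy), h.right_id k hk x hxk]
  · rw [h.eq_min x y hk, min_eq_left (hx.trans hy)]

theorem eq_right_of_between {e x y : E} (he : ∀ k ∈ K, e ≤ l k ∨ r k ≤ e) (hx : e ≤ x) (hy : y ≤ e) :
    A x y = y := by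
  rw [h.comm, h.eq_left_of_between he hy hx]

theorem le_op {e x y : E} (he : ∀ k ∈ K, e ≤ l k ∨ r k ≤ e) (hx : e ≤ x) (hy : e ≤ y) :
    e ≤ A x y := by
  by_cases hk : ∃ k ∈ K, x ∈ Icc (l k) (r k) ∧ y ∈ Icc (l k) (r k)
  · obtain ⟨k, hk, hxk, hyk⟩ := hk
    rcases he k hk with h' | h'
    · exact h'.trans (h.mem k hk x hxk y hyk).1
    · rwa [hyk.2.antisymm (h'.trans hy), h.right_id k hk x hxk]
  · rw [h.eq_min x y hk]; exact le_min hx hy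

theorem right_outside {k : ι} (hk : k ∈ K) : ∀ j ∈ K, r k ≤ l j ∨ r j ≤ r k := fun j hj => by
  rcases eq_or_ne k j with rfl | hne
  · exact Or.inr le_rfl
  · exact (h.separated k hk j hj hne).imp id (fun h' => h'.trans (h.lt k hk).le)

/-- Three elements which do not share a block are separated by a point outside all open blocks. -/
theorem exists_between (x y z : E)
    (hk : ¬ ∃ k ∈ K, x ∈ Icc (l k) (r k) ∧ y ∈ Icc (l k) (r k) ∧ z ∈ Icc (l k) (r k)) :
    ∃ e, (∀ k ∈ K, e ≤ l k ∨ r k ≤ e) ∧ (x ≤ e ∨ y ≤ e ∨ z ≤ e) ∧ (e ≤ x ∨ e ≤ y ∨ e ≤ z) := by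
  obtain ⟨p, hp, hpx, hpy, hpz⟩ : ∃ p, (p = x ∨ p = y ∨ p = z) ∧ p ≤ x ∧ p ≤ y ∧ p ≤ z := by
    refine ⟨min x (min y z), ?_, by simp, by simp, by simp⟩
    rcases min_choice x (min y z) with h' | h' <;> rw [h']
    · exact Or.inl rfl
    · exact Or.inr (min_choice y z)
  by_cases hfree : ∀ k ∈ K, p ≤ l k ∨ r k ≤ p
  · exact ⟨p, hfree, hp.imp Eq.ge (Or.imp Eq.ge Eq.ge), Or.inl hpx⟩
  · push Not at hfree
    obtain ⟨k, hkK, hlk, hrk⟩ := hfree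
    -- The minimum `p` is interior to block `k`. Were all three elements below `r k`, they would
    -- share that block.
    refine ⟨r k, h.right_outside hkK, ?_, ?_⟩
    · rcases hp with rfl | rfl | rfl
      · exact Or.inl hrk.le
      · exact Or.inr (Or.inl hrk.le)
      · exact Or.inr (Or.inr hrk.le)
    · by_contra! hcon
      exact hk ⟨k, hkK, ⟨hlk.le.trans hpx, hcon.1.le⟩, ⟨hlk.le.trans hpy, hcon.2.1.le⟩,
        ⟨hlk.le.trans hpz, hcon.2.2.le⟩⟩

theorem assoc (x y z : E) : A (A x y) z = A x (A y z) := by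
  by_cases hk : ∃ k ∈ K, x ∈ Icc (l k) (r k) ∧ y ∈ Icc (l k) (r k) ∧ z ∈ Icc (l k) (r k)
  · obtain ⟨k, hk, hx, hy, hz⟩ := hk
    exact h.assoc' k hk x hx y hy z hz
  obtain ⟨e, he, hmin, hmax⟩ := h.exists_between x y z hk
  have L : ∀ {u v}, u ≤ e → e ≤ v → A u v = u := h.eq_left_of_between he
  have R : ∀ {u v}, e ≤ u → v ≤ e → A u v = v := h.eq_right_of_between he
  have U : ∀ {u v}, e ≤ u → e ≤ v → e ≤ A u v := h.le_op he
  -- Six cases with one element on one side of `e` and two on the other. If all lie on one side,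
  -- `hmin` or `hmax` makes one of them equal to `e`, so a listed case still applies.
  have c₁ : x ≤ e → e ≤ y → e ≤ z → A (A x y) z = A x (A y z) := fun hx hy hz => by
    rw [L hx hy, L hx hz, L hx (U hy hz)]
  have c₂ : y ≤ e → e ≤ x → e ≤ z → A (A x y) z = A x (A y z) := fun hy hx hz => by
    rw [R hx hy, L hy hz, R hx hy]
  have c₃ : z ≤ e → e ≤ x → e ≤ y → A (A x y) z = A x (A y z) := fun hz hx hy => by
    rw [R (U hx hy) hz, R hy hz, R hx hz]
  have c₄ : e ≤ x → y ≤ e → z ≤ e → A (A x y) z = A x (A y z) := fun hx hy hz => by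
    rw [R hx hy, R hx ((h.le_left _ _).trans hy)]
  have c₅ : e ≤ y → x ≤ e → z ≤ e → A (A x y) z = A x (A y z) := fun hy hx hz => by
    rw [L hx hy, R hy hz]
  have c₆ : e ≤ z → x ≤ e → y ≤ e → A (A x y) z = A x (A y z) := fun hz hx hy => by
    rw [L ((h.le_left _ _).trans hx) hz, L hy hz]
  clear L R U he hk
  rcases le_total x e with hx | hx <;> rcases le_total y e with hy | hy <;>
    rcases le_total z e with hz | hz <;> grind only

theorem mono_left {x x' : E} (y : E) (hx : x ≤ x') : A x y ≤ A x' y := by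
  by_cases hk : ∃ k ∈ K, x ∈ Icc (l k) (r k) ∧ x' ∈ Icc (l k) (r k) ∧ y ∈ Icc (l k) (r k)
  · obtain ⟨k, hk, hxk, hxk', hy⟩ := hk
    exact h.mono' k hk x hxk x' hxk' y hy hx
  obtain ⟨e, he, hmin, hmax⟩ := h.exists_between x x' y hk
  have L : ∀ {u v}, u ≤ e → e ≤ v → A u v = u := h.eq_left_of_between he
  have R : ∀ {u v}, e ≤ u → v ≤ e → A u v = v := h.eq_right_of_between he
  have c₁ : x' ≤ e → e ≤ y → A x y ≤ A x' y := fun h' hy => by rwa [L (hx.trans h') hy, L h' hy]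
  have c₂ : e ≤ x' → y ≤ e → A x y ≤ A x' y := fun h' hy => by
    rw [R h' hy]; exact h.le_right _ _
  have c₃ : x ≤ e → e ≤ x' → e ≤ y → A x y ≤ A x' y := fun hxe h' hy => by
    rw [L hxe hy]; exact hxe.trans (h.le_op he h' hy)
  have c₄ : e ≤ x → e ≤ x' := fun h' => h'.trans hx
  have c₅ : x' ≤ e → x ≤ e := fun h' => hx.trans h'
  clear L R he hk
  rcases le_total x e with hxe | hxe <;> rcases le_total x' e with hx' | hx' <;>
    rcases le_total y e with hy | hy <;> grind only

theorem mono_right (x : E) {y y' : E} (hy : y ≤ y') : A x y ≤ A x y' := by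
  rw [h.comm x y, h.comm x y']; exact h.mono_left x hy

theorem exists_op_eq {x w : E} (hw : w ≤ x) : ∃ y, A x y = w := by
  by_cases hk : ∃ k ∈ K, x ∈ Icc (l k) (r k) ∧ w ∈ Icc (l k) (r k)
  · obtain ⟨k, hk, hxk, hwk⟩ := hk
    exact h.surj' k hk x hxk w hwk hw
  · exact ⟨w, by rw [h.eq_min x w hk, min_eq_right hw]⟩

variable [TopologicalSpace E] [OrderTopology E] [DenselyOrdered E]

/-- A monotone map onto the whole of `Iic x` cannot jump. -/
theorem continuous_right (x : E) : Continuous (A x) := by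
  let g : E → Iic x := fun y => ⟨A x y, h.le_left x y⟩
  have hg : Monotone g := fun y y' hy => h.mono_right x hy
  have hs : Function.Surjective g := fun w => by
    obtain ⟨y, hy⟩ := h.exists_op_eq w.2
    exact ⟨y, Subtype.ext hy⟩
  exact continuous_subtype_val.comp (hg.continuous_of_surjective hs)

/-- For an operation monotone in each variable, separate continuity implies joint continuity: a
bound at one corner of a rectangle controls the whole rectangle. -/
theorem continuous : Continuous fun p : E × E => A p.1 p.2 := by
  have hleft : ∀ y, Continuous fun x => A x y := fun y => by
    simpa only [h.comm _ y] using h.continuous_right y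
  refine continuous_iff_continuousAt.2 fun ⟨x, y⟩ => tendsto_order.2 ⟨fun c hc => ?_, fun c hc => ?_⟩
  · obtain ⟨x₁, x₂, hx, hx', hs⟩ := exists_Icc_mem_subset_of_mem_nhds
      ((hleft y).continuousAt.eventually_const_lt hc)
    have hc' : c < A x₁ y := hs (left_mem_Icc.2 (hx.1.trans hx.2))
    obtain ⟨y₁, y₂, hy, hy', ht⟩ := exists_Icc_mem_subset_of_mem_nhds
      ((h.continuous_right x₁).continuousAt.eventually_const_lt hc')
    have hc'' : c < A x₁ y₁ := ht (left_mem_Icc.2 (hy.1.trans hy.2))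
    filter_upwards [prod_mem_nhds hx' hy'] with p hp
    exact hc''.trans_le ((h.mono_left _ hp.1.1).trans (h.mono_right _ hp.2.1))
  · obtain ⟨x₁, x₂, hx, hx', hs⟩ := exists_Icc_mem_subset_of_mem_nhds
      ((hleft y).continuousAt.eventually_lt_const hc)
    have hc' : A x₂ y < c := hs (right_mem_Icc.2 (hx.1.trans hx.2))
    obtain ⟨y₁, y₂, hy, hy', ht⟩ := exists_Icc_mem_subset_of_mem_nhds
      ((h.continuous_right x₂).continuousAt.eventually_lt_const hc')
    have hc'' : A x₂ y₂ < c := ht (right_mem_Icc.2 (hy.1.trans hy.2))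
    filter_upwards [prod_mem_nhds hx' hy'] with p hp
    exact ((h.mono_left _ hp.1.2).trans (h.mono_right _ hp.2.2)).trans_lt hc''

end IsOrdinalSum

/-! ### Generated operations form ordinal sums -/

namespace IsConjGenerator

variable {c d : ℝ} {f : ℝ → ENNReal} (hf : IsConjGenerator c d f)
include hf

theorem exists_eq (hcd : c ≤ d) {t : ENNReal} (ht : t ≤ f c) : ∃ x ∈ Icc c d, f x = t :=
  intermediate_value_Icc' hcd hf.continuousOn ⟨by simp [hf.map_right], ht⟩

theorem generatedOp_mem (hcd : c ≤ d) (x y : ℝ) : generatedOp c d f x y ∈ Icc c d :=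
  Function.invFunOn_mem (hf.exists_eq hcd (min_le_right (f x + f y) _))

theorem map_generatedOp (hcd : c ≤ d) (x y : ℝ) :
    f (generatedOp c d f x y) = min (f x + f y) (f c) :=
  Function.invFunOn_eq (hf.exists_eq hcd (min_le_right (f x + f y) _))

theorem map_le_left {x : ℝ} (hx : x ∈ Icc c d) : f x ≤ f c :=
  hf.strictAntiOn.antitoneOn (left_mem_Icc.2 (hx.1.trans hx.2)) hx hx.1

/-- Under `f` both sides become `f x + f y + f z` truncated at `f c`; truncating a partial sum first
changes nothing. -/
theorem generatedOp_assoc (hcd : c ≤ d) (x y z : ℝ) :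
    generatedOp c d f (generatedOp c d f x y) z = generatedOp c d f x (generatedOp c d f y z) := by
  refine hf.generatedOp_eq (hf.generatedOp_mem hcd _ _) ?_
  simp only [hf.map_generatedOp hcd]
  have key : ∀ s t m : ENNReal, min (min s m + t) m = min (s + t) m := fun s t m => by
    rcases le_total s m with h | h
    · rw [min_eq_left h]
    · rw [min_eq_right h, min_eq_right le_self_add, min_eq_right (h.trans le_self_add)]
  rw [key, add_comm (f x), key, add_comm _ (f x), add_assoc]

theorem generatedOp_mono (hcd : c ≤ d) {x x' : ℝ} (hx : x ∈ Icc c d) (hx' : x' ∈ Icc c d) (y : ℝ)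
    (h : x ≤ x') : generatedOp c d f x y ≤ generatedOp c d f x' y := by
  refine (hf.strictAntiOn.le_iff_ge (hf.generatedOp_mem hcd _ _) (hf.generatedOp_mem hcd _ _)).1 ?_
  simp only [hf.map_generatedOp hcd]
  gcongr
  exact hf.strictAntiOn.antitoneOn hx hx' h

theorem generatedOp_right {x : ℝ} (hx : x ∈ Icc c d) : generatedOp c d f x d = x :=
  hf.generatedOp_eq hx (by rw [hf.map_right, add_zero, min_eq_left (hf.map_le_left hx)])

theorem generatedOp_left (hcd : c ≤ d) (x : ℝ) : generatedOp c d f x c = c :=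
  hf.generatedOp_eq (left_mem_Icc.2 hcd) (min_eq_right le_add_self).symm

theorem exists_generatedOp_eq {x w : ℝ} (hx : x ∈ Icc c d) (hw : w ∈ Icc c d) (h : w ≤ x) :
    ∃ y ∈ Icc c d, generatedOp c d f x y = w := by
  -- The solution has `f y = f w - f x`. If `f x = ⊤` then `f w = ⊤` as well, and adding `f x` back
  -- still gives `f w`.
  obtain ⟨y, hy, hfy⟩ := hf.exists_eq (hx.1.trans hx.2)
    ((tsub_le_self (a := f w) (b := f x)).trans (hf.map_le_left hw))
  refine ⟨y, hy, hf.generatedOp_eq hw ?_⟩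
  rw [hfy, add_tsub_cancel_of_le (hf.strictAntiOn.antitoneOn hw hx h),
    min_eq_left (hf.map_le_left hw)]

end IsConjGenerator

theorem generatedOp_comm (c d : ℝ) (f : ℝ → ENNReal) (x y : ℝ) :
    generatedOp c d f x y = generatedOp c d f y x := by
  rw [generatedOp, generatedOp, add_comm]

theorem IsConjOrdinalSumOp.exists_isOrdinalSum {a b : ℝ} (hab : a ≤ b)
    {A : Icc a b → Icc a b → Icc a b} (h : IsConjOrdinalSumOp A) :
    ∃ (K : Set ℕ) (l r : ℕ → Icc a b), IsOrdinalSum A K l r := by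
  obtain ⟨K, l, r, f, hlr, hdisj, hf, hA⟩ := h
  -- The projection only lifts endpoints into `Icc a b`; for `k ∈ K` it does not move them.
  set l' : ℕ → Icc a b := fun k => projIcc a b hab (l k) with hl'
  set r' : ℕ → Icc a b := fun k => projIcc a b hab (r k) with hr'
  have hl : ∀ k ∈ K, (l' k : ℝ) = l k := fun k hk => by
    obtain ⟨h₁, h₂, h₃⟩ := hlr k hk
    simp only [hl', projIcc_of_mem hab ⟨h₁, h₂.le.trans h₃⟩]
  have hr : ∀ k ∈ K, (r' k : ℝ) = r k := fun k hk => by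
    obtain ⟨h₁, h₂, h₃⟩ := hlr k hk
    simp only [hr', projIcc_of_mem hab ⟨h₁.trans h₂.le, h₃⟩]
  have hlt : ∀ k ∈ K, l k < r k := fun k hk => (hlr k hk).2.1
  have hmem : ∀ k ∈ K, ∀ x : Icc a b, x ∈ Icc (l' k) (r' k) ↔ (x : ℝ) ∈ Icc (l k) (r k) :=
    fun k hk x => by rw [← hl k hk, ← hr k hk]; rfl
  have hop : ∀ k ∈ K, ∀ x ∈ Icc (l' k) (r' k), ∀ y ∈ Icc (l' k) (r' k),
      (A x y : ℝ) = generatedOp (l k) (r k) (f k) x y := fun k hk x hx y hy =>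
    (hA x y).1 k hk ((hmem k hk x).1 hx) ((hmem k hk y).1 hy)
  have hAmem : ∀ k ∈ K, ∀ x ∈ Icc (l' k) (r' k), ∀ y ∈ Icc (l' k) (r' k),
      A x y ∈ Icc (l' k) (r' k) := fun k hk x hx y hy => by
    rw [hmem k hk, hop k hk x hx y hy]
    exact (hf k hk).generatedOp_mem (hlt k hk).le _ _
  have hlr' : ∀ k ∈ K, l' k < r' k := fun k hk => by
    rw [← Subtype.coe_lt_coe, hl k hk, hr k hk]; exact hlt k hk
  refine ⟨K, l', r', hlr', ?_, hAmem, ?_, ?_, ?_, ?_, ?_, ?_, ?_⟩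
  · intro k hk j hj hne
    have := Ioo_disjoint_Ioo.1 (hdisj hk hj hne)
    simp only [← Subtype.coe_le_coe, hl k hk, hr k hk, hl j hj, hr j hj]
    rcases min_le_iff.1 this with h' | h' <;> rcases le_max_iff.1 h' with h'' | h''
    · exact absurd (hlt k hk) h''.not_gt
    · exact Or.inl h''
    · exact Or.inr h''
    · exact absurd (hlt j hj) h''.not_gt
  · intro k hk x hx y hy
    rw [Subtype.ext_iff, hop k hk x hx y hy, hop k hk y hy x hx, generatedOp_comm]
  · intro k hk x hx y hy z hz
    rw [Subtype.ext_iff, hop k hk _ (hAmem k hk x hx y hy) z hz, hop k hk x hx y hy,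
      hop k hk x hx _ (hAmem k hk y hy z hz), hop k hk y hy z hz]
    exact (hf k hk).generatedOp_assoc (hlt k hk).le _ _ _
  · intro k hk x hx x' hx' y hy hxx'
    rw [← Subtype.coe_le_coe, hop k hk x hx y hy, hop k hk x' hx' y hy]
    exact (hf k hk).generatedOp_mono (hlt k hk).le ((hmem k hk x).1 hx) ((hmem k hk x').1 hx') _ hxx'
  · intro k hk x hx
    rw [Subtype.ext_iff, hop k hk x hx _ (left_mem_Icc.2 (hlr' k hk).le), hl k hk]
    exact (hf k hk).generatedOp_left (hlt k hk).le _
  · intro k hk x hx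
    rw [Subtype.ext_iff, hop k hk x hx _ (right_mem_Icc.2 (hlr' k hk).le), hr k hk]
    exact (hf k hk).generatedOp_right ((hmem k hk x).1 hx)
  · intro k hk x hx w hw hwx
    obtain ⟨y, hy, hyw⟩ :=
      (hf k hk).exists_generatedOp_eq ((hmem k hk x).1 hx) ((hmem k hk w).1 hw) hwx
    have hy' : y ∈ Icc a b := ⟨(hlr k hk).1.trans hy.1, hy.2.trans (hlr k hk).2.2⟩
    refine ⟨⟨y, hy'⟩, Subtype.ext ?_⟩
    rw [hop k hk x hx ⟨y, hy'⟩ ((hmem k hk _).2 hy), hyw]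
  · intro x y hxy
    refine (hA x y).2 fun ⟨k, hk, hx, hy⟩ => hxy ⟨k, hk, (hmem k hk x).2 hx, (hmem k hk y).2 hy⟩

theorem IsMinOp.isConjOrdinalSumOp {a b : ℝ} {A : Icc a b → Icc a b → Icc a b} (h : IsMinOp A) :
    IsConjOrdinalSumOp A :=
  ⟨∅, fun _ => 0, fun _ => 0, fun _ _ => 0, by simp, by simp, by simp, fun x y => by simp [h x y]⟩

theorem IsConjArchimedeanOp.isConjOrdinalSumOp {a b : ℝ} (hab : a ≤ b)
    {A : Icc a b → Icc a b → Icc a b} (h : IsConjArchimedeanOp A) : IsConjOrdinalSumOp A := by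
  -- Blocks must be nondegenerate, so a one-point interval is treated as the minimum with no blocks.
  rcases hab.eq_or_lt with rfl | hlt
  · exact IsMinOp.isConjOrdinalSumOp fun x y => Subsingleton.elim _ _
  · obtain ⟨f, hf, hA⟩ := h
    exact ⟨{0}, fun _ => a, fun _ => b, fun _ => f, by simp [hlt], by simp, by simpa using hf,
      fun x y => ⟨fun _ _ _ _ => hA x y, fun hn => absurd ⟨0, rfl, x.2, y.2⟩ hn⟩⟩

theorem theorem4p5 (a b : ℝ) (hab : a ≤ b) (A : Set.Icc a b → Set.Icc a b → Set.Icc a b) :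
    (Continuous (fun p : Set.Icc a b × Set.Icc a b => A p.1 p.2) ∧ IsAssociativeOp A ∧
      IsZeroElt A ⟨a, Set.left_mem_Icc.2 hab⟩ ∧ IsIdentityElt A ⟨b, Set.right_mem_Icc.2 hab⟩) ↔
    (IsMinOp A ∨ IsConjArchimedeanOp A ∨ IsConjOrdinalSumOp A) := by
  refine ⟨fun ⟨hc, ha, h0, h1⟩ => Or.inr (Or.inr (isConjOrdinalSumOp_of_continuous hab hc ha h0 h1)),
    fun h => ?_⟩
  have hsum : IsConjOrdinalSumOp A := by
    rcases h with h | h | h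
    exacts [h.isConjOrdinalSumOp, h.isConjOrdinalSumOp hab, h]
  obtain ⟨K, l, r, hO⟩ := hsum.exists_isOrdinalSum hab
  refine ⟨hO.continuous, hO.assoc, fun x => ?_, fun x => ?_⟩
  · exact ⟨(hO.le_left _ x).antisymm (A _ x).2.1, (hO.le_right x _).antisymm (A x _).2.1⟩
  -- The point `b` lies outside every open block, so the threshold property at `b` makes it an
  -- identity.
  · have hb : ∀ k ∈ K, (⟨b, right_mem_Icc.2 hab⟩ : Icc a b) ≤ l k ∨ r k ≤ ⟨b, right_mem_Icc.2 hab⟩ :=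
      fun k _ => Or.inr (r k).2.2
    exact ⟨hO.eq_right_of_between hb le_rfl x.2.2, hO.eq_left_of_between hb x.2.2 le_rfl⟩
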